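/- For a set $X$ let $\Omega_X=\{[_x,\,]_x \mid x\in X\}$ be the alphabet of brackets labelled by $X$, and let $D_X\subseteq\Omega_X^*$ be the Dyck language, generated by the grammar $S\to[_x\,S\,]_x$ ($x\in X$), $S\to SS$, $S\to\varepsilon$. For a finite alphabet $\Sigma$ put $X=\Sigma\cup\{c,d\}$, where $c,d$ are two new symbols, and $\Omega=\Omega_X$, $D=D_X$ (so, writing $x$ for $[_x$ and $x'$ for $]_x$, $\Omega=\Sigma\cup\Sigma'\cup\{c,c',d,d'\}$). Let $h:\Omega^*\to\Sigma^*$ be the erasing alphabetic homomorphism that maps $a$ to $a$ for every $a\in\Sigma$ and erases every letter of $\Sigma'\cup\{c,c',d,d'\}$. For $k\ge 2$, a language $R\subseteq\Omega^+$ is called $k$-strictly locally testable ($k$-SLT) if there are finite sets $W\subseteq\Omega\cup\Omega^2\cup\dots\cup\Omega^{k-1}$, $I,T\subseteq\Omega^{k-1}$ and $F\subseteq\Omega^k$ such that for every $x\in\Omega^+$: $x\in R$ if and only if $x\in W$, or the prefix of $x$ of length $k-1$ is in $I$, the suffix of $x$ of length $k-1$ is in $T$, and all factors of $x$ of length $k$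 are in $F$ (the prefix and the suffix being $x$ itself if $|x|<k-1$). There is a function $k:\mathbb N\to\mathbb N$ with $k(n)=O(\log n)$ such that, for every finite alphabet $\Sigma$ and with $\Omega$, $D$, $h$ as above: 1. $|\Omega|=2|\Sigma|+4$. 2. A language $L\subseteq\Sigma^*$ is context-free if and only if $L=h(D\cap R)$ for some regular language $R\subseteq\Omega^*$. 3. If $L=L(G)$ for a context-free grammar $G$ in Chomsky normal form (every right-hand side is a single terminal or a product of two nonterminals) with rule set $P$, then there is a regular language $R\subseteq\Omega^*$ such that $L=h(D\cap R)$ and $R$ is $k$-SLT with $k=k(|P|)=O(\log|P|)$. -/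

import Mathlib

/-- The Dyck alphabet over a set `X` of labels: an opening and a closing bracket for each label. -/
inductive DyckBracket (X : Type*) : Type _
  | opening (x : X) : DyckBracket X
  | closing (x : X) : DyckBracket X

/-- Membership in the Dyck language over `X`, the language generated by the context-free grammar
`S → [ₓ S ]ₓ` (for each label `x`), `S → S S`, `S → ε`. -/
inductive IsDyckWord {X : Type*} : List (DyckBracket X) → Prop
  | nil : IsDyckWord []
  | append (u v : List (DyckBracket X)) (hu : IsDyckWord u) (hv : IsDyckWord v) : IsDyckWord (u ++ v)
  | nest (x : X) (u : List (DyckBracket X)) (hu : IsDyckWord u) :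
      IsDyckWord ([DyckBracket.opening x] ++ u ++ [DyckBracket.closing x])

/-- The Dyck language over the set `X` of labels. -/
def dyckLanguage (X : Type*) : Language (DyckBracket X) :=
  {w : List (DyckBracket X) | IsDyckWord w}

/-- The image `h(L)` of a language under the monoid homomorphism determined by a map `h` from
letters to words. -/
def homImage {Δ Γ : Type*} (h : Δ → List Γ) (L : Language Δ) : Language Γ :=
  {w : List Γ | ∃ v ∈ L, v.flatMap h = w}

/-- The labels of Stanley's Dyck alphabet: the terminal letters and two extra letters `c`, `d`. -/
inductive StanleyLabel (T : Type*) : Type _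
  | letter (a : T) : StanleyLabel T
  | c : StanleyLabel T
  | d : StanleyLabel T

/-- Stanley's Dyck alphabet `T ∪ T' ∪ {c, c', d, d'}`: the opening brackets are the letters of
`T ∪ {c, d}`, and the closing brackets are their primed copies. -/
abbrev StanleyAlphabet (T : Type*) : Type _ := DyckBracket (StanleyLabel T)

/-- Stanley's erasing alphabetic homomorphism: it maps (the opening bracket labelled by) a terminal
letter to that letter and erases `c`, `d` and all primed letters. -/
def stanleyHom {T : Type*} : StanleyAlphabet T → List T
  | DyckBracket.opening (StanleyLabel.letter a) => [a]
  | DyckBracket.opening StanleyLabel.c => []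
  | DyckBracket.opening StanleyLabel.d => []
  | DyckBracket.closing _ => []

/-- Chomsky normal form: every right-hand side is a terminal or a pair of nonterminals. -/
def IsChomskyNF {T : Type*} (G : ContextFreeGrammar T) : Prop :=
  ∀ r ∈ G.rules, (∃ a : T, r.output = [Symbol.terminal a]) ∨
    ∃ A B : G.NT, r.output = [Symbol.nonterminal A, Symbol.nonterminal B]

/-- The prefix of length `n` of `w`, or `w` itself if it is shorter than `n`. -/
def wordPrefix {α : Type*} (n : ℕ) (w : List α) : List α := w.take n

/-- The suffix of length `n` of `w`, or `w` itself if it is shorter than `n`. -/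
def wordSuffix {α : Type*} (n : ℕ) (w : List α) : List α := w.drop (w.length - n)

/-- The set of factors of length `n` of `w` (empty if `w` is shorter than `n`). -/
def wordFactors {α : Type*} (n : ℕ) (w : List α) : Set (List α) :=
  {u : List α | u <:+: w ∧ u.length = n}

/-- `k`-strictly locally testable languages (`k ≥ 2`); only languages without the empty word are
considered. -/
def IsSLT {α : Type*} (k : ℕ) (L : Language α) : Prop :=
  2 ≤ k ∧ [] ∉ L ∧
    ∃ W I T F : Finset (List α),
      (∀ w ∈ W, 1 ≤ w.length ∧ w.length ≤ k - 1) ∧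
      (∀ w ∈ I, w.length = k - 1) ∧
      (∀ w ∈ T, w.length = k - 1) ∧
      (∀ w ∈ F, w.length = k) ∧
      ∀ x : List α, x ≠ [] →
        (x ∈ L ↔ x ∈ W ∨
          (wordPrefix (k - 1) x ∈ I ∧ wordSuffix (k - 1) x ∈ T ∧ wordFactors k x ⊆ ↑F))

/-!
A regular set is used to single out encodings of derivation trees among the Dyck words. In the
encoding, a leaf `A → a` becomes the pair `[ₐ ]ₐ`, and a node with the rule `π : A → B C` becomes
the encodings of its two subtrees, the first one bracketed by a code word for `(π, false)` and its
mirror image, the second one by a code word for `(π, true)` and its mirror image. The code words all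
have the same length `n` and consist of the opening brackets of `c` and `d`, which `stanleyHom`
erases, so the image of the encoding is the yield of the tree.

The regular set is recognised by a nondeterministic automaton (`BinaryGrammar.automaton`) whose
states are the positions in encodings, and whose transitions only check what is visible locally: a
code word of `(π, false)` is followed by a tree with root `B`, the closing code word of `(π, false)`
by the opening code word of `(π, true)`, and the end of a tree by the closing code word of anything.
That this is the right closing code word is enforced by the Dyck property, since brackets match
letter by letter and code words are distinct. This gives `BinaryGrammar.mem_homImage_iff_yields`.

Strict local testability comes from a criterion on automata (`NFA.isSLT_accepts`): windows of length
`k` suffice as soon as two runs over the same word of length `k - 1` can always be crossed, because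
then the runs of overlapping windows can be glued. Runs of the automaton can be crossed if the code
words have the form `cc d b₀ d b₁ … d`, in which `cc` marks the beginning: within `4 n + 1` letters,
two runs meet a leaf, or finish a code word simultaneously (`BinaryGrammar.exists_sync`). Binary
code words for `2 |P|` objects have length `n = O(log |P|)`.

An arbitrary context-free grammar is reduced to the same construction by taking suffixes of
right-hand sides as nonterminals, with the pair `d d'` as the encoding of a leaf with empty yield; no
locality is needed there. Conversely, the image of the Dyck words accepted by a finite automaton is
generated by the grammar whose nonterminals are pairs of states
(`isContextFree_homImage_dyckLanguage_inf`).
-/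

/-! ### The size of the alphabet -/

/-- A bracket is a label together with a side. -/
def DyckBracket.equivSum (X : Type*) : DyckBracket X ≃ X ⊕ X where
  toFun
    | .opening x => .inl x
    | .closing x => .inr x
  invFun := Sum.elim .opening .closing
  left_inv b := by cases b <;> rfl
  right_inv s := by cases s <;> rfl

/-- A label is a letter or one of two extra symbols. -/
def StanleyLabel.equivOption (T : Type*) : StanleyLabel T ≃ Option (Option T) where
  toFun
    | .letter a => some (some a)
    | .c => some none
    | .d => none
  invFun
    | some (some a) => .letter a
    | some none => .c
    | none => .d
  left_inv x := by cases x <;> rfl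
  right_inv o := by rcases o with _ | _ | a <;> rfl

instance (X : Type*) [Finite X] : Finite (DyckBracket X) :=
  .of_equiv _ (DyckBracket.equivSum X).symm

instance (T : Type*) [Finite T] : Finite (StanleyLabel T) :=
  .of_equiv _ (StanleyLabel.equivOption T).symm

theorem card_stanleyAlphabet (T : Type*) [Finite T] :
    Nat.card (StanleyAlphabet T) = 2 * Nat.card T + 4 := by
  rw [Nat.card_congr (DyckBracket.equivSum _), Nat.card_sum,
    Nat.card_congr (StanleyLabel.equivOption T), Finite.card_option, Finite.card_option]
  ring

/-! ### Dyck words -/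

/-- Every nonempty Dyck word splits at the partner of its first bracket. -/
theorem IsDyckWord.exists_decomposition {X : Type*} {u : List (DyckBracket X)} (hu : IsDyckWord u) :
    u = [] ∨ ∃ x v r, IsDyckWord v ∧ IsDyckWord r ∧
      u = DyckBracket.opening x :: (v ++ DyckBracket.closing x :: r) := by
  induction hu with
  | nil => exact .inl rfl
  | append u v _ hv ihu ihv =>
    rcases ihu with rfl | ⟨x, u₁, r, h₁, hr, rfl⟩
    · simpa using ihv
    · exact .inr ⟨x, u₁, r ++ v, h₁, .append _ _ hr hv, by simp⟩
  | nest x u hu _ => exact .inr ⟨x, u, [], hu, .nil, by simp⟩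

theorem IsDyckWord.cons_append_cons {X : Type*} (x : X) {v r : List (DyckBracket X)}
    (hv : IsDyckWord v) (hr : IsDyckWord r) :
    IsDyckWord (DyckBracket.opening x :: (v ++ DyckBracket.closing x :: r)) := by
  simpa using IsDyckWord.append _ _ (.nest x v hv) hr

/-- Induction on Dyck words along the unambiguous grammar `S → [ₓ S ]ₓ S`, `S → ε`. -/
@[elab_as_elim]
theorem IsDyckWord.first_return_induction {X : Type*}
    {motive : ∀ u : List (DyckBracket X), IsDyckWord u → Prop}
    (nil : motive [] .nil)
    (cons : ∀ x v r (hv : IsDyckWord v) (hr : IsDyckWord r), motive v hv → motive r hr →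
      motive (DyckBracket.opening x :: (v ++ DyckBracket.closing x :: r))
        (.cons_append_cons x hv hr))
    {u : List (DyckBracket X)} (hu : IsDyckWord u) : motive u hu := by
  induction hn : u.length using Nat.strong_induction_on generalizing u with
  | _ n ih =>
    rcases hu.exists_decomposition with rfl | ⟨x, v, r, hv, hr, rfl⟩
    · exact nil
    · simp only [List.length_cons, List.length_append] at hn
      exact cons x v r hv hr (ih _ (by omega) hv rfl) (ih _ (by omega) hr rfl)

/-- Wrapping a Dyck word into a string of opening brackets and the mirror image of it. -/
theorem IsDyckWord.wrap {X : Type*} (l : List X) {u : List (DyckBracket X)} (hu : IsDyckWord u) :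
    IsDyckWord (l.map DyckBracket.opening ++ u ++ (l.map DyckBracket.closing).reverse) := by
  induction l with
  | nil => simpa using hu
  | cons x l ih => simpa using IsDyckWord.nest x _ ih

/-! ### Runs of automata and strict local testability -/

namespace NFA

variable {α σ : Type*} (M : NFA α σ)

/-- The automaton can read the word `w` on a way from the state `p` to the state `q`. -/
def Runs (p : σ) (w : List α) (q : σ) : Prop := q ∈ M.evalFrom {p} w

variable {M}

@[simp] theorem runs_nil {p q : σ} : M.Runs p [] q ↔ q = p := by simp [Runs]

theorem runs_append {p q : σ} {u v : List α} :
    M.Runs p (u ++ v) q ↔ ∃ r, M.Runs p u r ∧ M.Runs r v q := by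
  unfold Runs
  rw [evalFrom_append, mem_evalFrom_iff_exists]

theorem runs_singleton {p q : σ} {x : α} : M.Runs p [x] q ↔ q ∈ M.step p x := by simp [Runs]

theorem runs_cons {p q : σ} {x : α} {w : List α} :
    M.Runs p (x :: w) q ↔ ∃ r ∈ M.step p x, M.Runs r w q := by
  rw [← List.singleton_append, runs_append]
  simp only [runs_singleton]

theorem mem_accepts_iff_runs {w : List α} :
    w ∈ M.accepts ↔ ∃ s ∈ M.start, ∃ f ∈ M.accept, M.Runs s w f := by
  simp only [mem_accepts, mem_evalFrom_iff_exists (S := M.start), Runs]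
  grind

/-- A run is the same thing as a sequence of states. -/
theorem runs_iff_exists_seq {p q : σ} {w : List α} :
    M.Runs p w q ↔ ∃ ρ : ℕ → σ, ρ 0 = p ∧ ρ w.length = q ∧
      ∀ i (h : i < w.length), ρ (i + 1) ∈ M.step (ρ i) w[i] := by
  induction w generalizing p with
  | nil =>
    rw [runs_nil]
    refine ⟨fun h => ⟨fun _ => p, rfl, h.symm, by simp⟩, ?_⟩
    rintro ⟨ρ, rfl, rfl, -⟩
    rfl
  | cons x w ih =>
    rw [runs_cons]
    constructor
    · rintro ⟨r, hr, hrun⟩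
      obtain ⟨ρ, rfl, rfl, h⟩ := ih.1 hrun
      refine ⟨fun i => Nat.casesOn i p ρ, rfl, rfl, ?_⟩
      rintro (_ | i) hi
      · exact hr
      · exact h i (by simpa using hi)
    · rintro ⟨ρ, rfl, rfl, h⟩
      refine ⟨ρ 1, h 0 (by simp), ih.2 ⟨fun i => ρ (i + 1), rfl, rfl, fun i hi => ?_⟩⟩
      exact h (i + 1) (by simpa using hi)

theorem isRegular_accepts [Finite σ] (M : NFA α σ) : M.accepts.IsRegular :=
  Language.isRegular_iff.2 ⟨Set σ, Fintype.ofFinite _, M.toDFA, M.toDFA_correct⟩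

/-- If any two runs over the same word of length `k - 1` can be crossed, then windows of length `k`
suffice to recognise the accepted words: the runs of overlapping windows glue to a run of the whole
word. -/
theorem isSLT_accepts [Finite α] {k : ℕ} (hk : 2 ≤ k) (hnil : [] ∉ M.accepts)
    (hcross : ∀ (w : List α) (p p' q q' : σ), w.length = k - 1 →
      M.Runs p w q → M.Runs p' w q' → M.Runs p w q') :
    IsSLT k M.accepts := by
  have hfin (n : ℕ) (P : List α → Prop) : {w : List α | w.length = n ∧ P w}.Finite :=
    (List.finite_length_eq α n).subset fun w hw => hw.1
  have hfinW : {w : List α | 1 ≤ w.length ∧ w.length ≤ k - 1 ∧ w ∈ M.accepts}.Finite :=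
    (List.finite_length_le α (k - 1)).subset fun w hw => hw.2.1
  refine ⟨hk, hnil, hfinW.toFinset,
    (hfin (k - 1) fun w => ∃ s ∈ M.start, ∃ q, M.Runs s w q).toFinset,
    (hfin (k - 1) fun w => ∃ p, ∃ f ∈ M.accept, M.Runs p w f).toFinset,
    (hfin k fun w => ∃ p q, M.Runs p w q).toFinset,
    fun w hw => ?_, fun w hw => ?_, fun w hw => ?_, fun w hw => ?_, fun x hx => ?_⟩
  · simp at hw; omega
  · simp at hw; exact hw.1
  · simp at hw; exact hw.1
  · simp at hw; exact hw.1
  simp only [Set.Finite.mem_toFinset, Set.mem_ofPred_eq, Set.Finite.coe_toFinset, wordPrefix,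
    wordSuffix]
  constructor
  · intro hacc
    have hpos : 1 ≤ x.length := List.length_pos_iff.2 hx
    by_cases hlen : x.length ≤ k - 1
    · exact .inl ⟨hpos, hlen, hacc⟩
    obtain ⟨s, hs, f, hf, hrun⟩ := mem_accepts_iff_runs.1 hacc
    refine .inr ⟨⟨by simp; omega, s, hs, ?_⟩, ⟨by simp; omega, ?_⟩, ?_⟩
    · rw [← List.take_append_drop (k - 1) x, runs_append] at hrun
      exact ⟨_, hrun.choose_spec.1⟩
    · rw [← List.take_append_drop (x.length - (k - 1)) x, runs_append] at hrun
      exact ⟨_, f, hf, hrun.choose_spec.2⟩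
    · rintro u ⟨⟨a, b, rfl⟩, hu⟩
      obtain ⟨q, hq, -⟩ := runs_append.1 hrun
      obtain ⟨p, -, hp⟩ := runs_append.1 hq
      exact ⟨hu, p, q, hp⟩
  · rintro (⟨-, -, h⟩ | ⟨⟨hlen, s, hs, q₀, hq₀⟩, ⟨-, p₁, f, hf, hp₁⟩, hF⟩)
    · exact h
    have hlen' : k - 1 ≤ x.length := by
      rw [List.length_take] at hlen; omega
    -- The last `k - 1` letters of a readable prefix tie its run to the run of the next window.
    have key (y : List α) (hy : y <+: x) (hky : k - 1 ≤ y.length) : ∃ q, M.Runs s y q := by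
      induction y using List.reverseRecOn with
      | nil => exact ⟨s, by simp⟩
      | append_singleton y a ih =>
        by_cases hyk : (y ++ [a]).length = k - 1
        · rw [List.prefix_iff_eq_take.1 hy, hyk]
          exact ⟨q₀, hq₀⟩
        have hyk' : k - 1 ≤ y.length := by simp at hyk hky; omega
        obtain ⟨q, hq⟩ := ih ((List.prefix_append y [a]).trans hy) hyk'
        have hwlen : (y.drop (y.length - (k - 1))).length = k - 1 := by simp; omega
        have hmem : y.drop (y.length - (k - 1)) ++ [a] ∈ wordFactors k x := by
          refine ⟨List.IsInfix.trans ?_ hy.isInfix, by rw [List.length_append, hwlen]; simp; omega⟩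
          refine ⟨y.take (y.length - (k - 1)), [], ?_⟩
          rw [List.append_nil, ← List.append_assoc, List.take_append_drop]
        obtain ⟨-, p', q', hrun'⟩ := hF hmem
        obtain ⟨r', hr', ha⟩ := runs_append.1 hrun'
        rw [← List.take_append_drop (y.length - (k - 1)) y, runs_append] at hq
        obtain ⟨r, hr, hrq⟩ := hq
        refine ⟨q', ?_⟩
        rw [← List.take_append_drop (y.length - (k - 1)) y, runs_append]
        exact ⟨r', runs_append.2 ⟨r, hr, hcross _ _ _ _ _ hwlen hrq hr'⟩, ha⟩
    obtain ⟨q, hq⟩ := key x List.prefix_rfl hlen'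
    rw [← List.take_append_drop (x.length - (k - 1)) x, runs_append] at hq
    obtain ⟨r, hr, hrq⟩ := hq
    refine mem_accepts_iff_runs.2 ⟨s, hs, f, hf, ?_⟩
    rw [← List.take_append_drop (x.length - (k - 1)) x, runs_append]
    exact ⟨r, hr, hcross _ _ _ _ _ (by simp; omega) hrq hp₁⟩

end NFA

/-! ### Derivation trees of context-free grammars -/

namespace ContextFreeGrammar

variable {T : Type*}

/-- `G.Yields α w`: the terminal word `w` is the yield of a forest of derivation trees of `G` whose
roots form the sentential form `α`. -/
inductive Yields (G : ContextFreeGrammar T) : List (Symbol T G.NT) → List T → Prop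
  | nil : Yields G [] []
  | terminal (a : T) {α : List (Symbol T G.NT)} {w : List T} (h : Yields G α w) :
      Yields G (Symbol.terminal a :: α) (a :: w)
  | rule {r : ContextFreeRule T G.NT} (hr : r ∈ G.rules) {α : List (Symbol T G.NT)} {u v : List T}
      (hu : Yields G r.output u) (hv : Yields G α v) :
      Yields G (Symbol.nonterminal r.input :: α) (u ++ v)

variable {G : ContextFreeGrammar T}

theorem yields_append {α β : List (Symbol T G.NT)} {w : List T} :
    G.Yields (α ++ β) w ↔ ∃ u v, w = u ++ v ∧ G.Yields α u ∧ G.Yields β v := by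
  constructor
  · induction α generalizing w with
    | nil => exact fun h => ⟨[], w, rfl, .nil, h⟩
    | cons s α ih =>
      intro h
      rw [List.cons_append] at h
      cases h with
      | terminal a h =>
        obtain ⟨u, v, rfl, hu, hv⟩ := ih h
        exact ⟨a :: u, v, rfl, .terminal a hu, hv⟩
      | rule hr hu hv =>
        obtain ⟨u', v', rfl, hu', hv'⟩ := ih hv
        exact ⟨_, v', (List.append_assoc ..).symm, .rule hr hu hu', hv'⟩
  · rintro ⟨u, v, rfl, hu, hv⟩
    induction hu with
    | nil => exact hv
    | terminal a _ ih => exact .terminal a ih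
    | rule hr hu _ _ ih =>
      rw [List.append_assoc]
      exact .rule hr hu ih

theorem yields_map_terminal (w : List T) : G.Yields (w.map Symbol.terminal) w := by
  induction w with
  | nil => exact .nil
  | cons a w ih => exact .terminal a ih

theorem Yields.derives {α : List (Symbol T G.NT)} {w : List T} (h : G.Yields α w) :
    G.Derives α (w.map Symbol.terminal) := by
  induction h with
  | nil => exact .refl _
  | terminal a _ ih => exact ih.append_left [Symbol.terminal a]
  | @rule r hr α u v _ _ ihu ihv =>
    rw [List.map_append]
    refine Produces.trans_derives ⟨r, hr, .head α⟩ ?_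
    exact (ihu.append_right α).trans (ihv.append_left _)

theorem yields_iff_derives {α : List (Symbol T G.NT)} {w : List T} :
    G.Yields α w ↔ G.Derives α (w.map Symbol.terminal) := by
  refine ⟨Yields.derives, fun h => ?_⟩
  induction h using Relation.ReflTransGen.head_induction_on with
  | refl => exact yields_map_terminal w
  | head hstep _ ih =>
    obtain ⟨r, hr, hrew⟩ := hstep
    obtain ⟨p, q, rfl, rfl⟩ := hrew.exists_parts
    obtain ⟨u', v, rfl, hu', hv⟩ := yields_append.1 ih
    obtain ⟨u, m, rfl, hu, hm⟩ := yields_append.1 hu'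
    refine yields_append.2 ⟨_, v, rfl, yields_append.2 ⟨u, m, rfl, hu, ?_⟩, hv⟩
    simpa using Yields.rule hr hm .nil

theorem mem_language_iff_yields {w : List T} :
    w ∈ G.language ↔ G.Yields [Symbol.nonterminal G.initial] w := by
  rw [mem_language_iff, yields_iff_derives]

theorem Yields.of_rule {r : ContextFreeRule T G.NT} (hr : r ∈ G.rules) {w : List T}
    (h : G.Yields r.output w) : G.Yields [Symbol.nonterminal r.input] w := by
  simpa using Yields.rule hr h .nil

/-- The words described by a sentential form when each nonterminal `A` stands for the set `I A`. -/
def interpret {N : Type*} (I : N → List T → Prop) : List (Symbol T N) → List T → Prop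
  | [], w => w = []
  | Symbol.terminal a :: α, w => ∃ v, w = a :: v ∧ interpret I α v
  | Symbol.nonterminal A :: α, w => ∃ u v, w = u ++ v ∧ I A u ∧ interpret I α v

/-- An interpretation of the nonterminals that is closed under the rules contains all yields. -/
theorem Yields.interpret {I : G.NT → List T → Prop}
    (hI : ∀ r ∈ G.rules, ∀ w, interpret I r.output w → I r.input w)
    {α : List (Symbol T G.NT)} {w : List T} (h : G.Yields α w) :
    ContextFreeGrammar.interpret I α w := by
  induction h with
  | nil => rfl
  | terminal a _ ih => exact ⟨_, rfl, ih⟩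
  | rule hr _ _ ihu ihv => exact ⟨_, _, rfl, hI _ hr _ ihu, ihv⟩

end ContextFreeGrammar

/-! ### Homomorphic images of regular sets of Dyck words are context-free -/

section DyckImage

variable {X T : Type*} {σ : Type}

/-- The rules of a grammar for the image under `h` of the Dyck words accepted by an automaton: the
nonterminal `some (p, q)` stands for the Dyck words that lead from the state `p` to the state `q`,
and `none` is the initial nonterminal. -/
inductive DyckImageRule (h : DyckBracket X → List T) (M : DFA (DyckBracket X) σ) :
    ContextFreeRule T (Option (σ × σ)) → Prop
  | start (f : σ) (hf : f ∈ M.accept) :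
      DyckImageRule h M ⟨none, [Symbol.nonterminal (some (M.start, f))]⟩
  | nil (p : σ) : DyckImageRule h M ⟨some (p, p), []⟩
  | cons (p q r : σ) (x : X) :
      DyckImageRule h M ⟨some (p, r),
        (h (.opening x)).map Symbol.terminal ++
          (Symbol.nonterminal (some (M.step p (.opening x), q)) ::
            ((h (.closing x)).map Symbol.terminal ++
              [Symbol.nonterminal (some (M.step q (.closing x), r))]))⟩

theorem finite_setOf_dyckImageRule [Finite X] [Finite σ] (h : DyckBracket X → List T)
    (M : DFA (DyckBracket X) σ) : {r | DyckImageRule h M r}.Finite := by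
  refine (((Set.finite_range fun f : σ => ContextFreeRule.mk none
    [Symbol.nonterminal (some (M.start, f))]).union
    (Set.finite_range fun p : σ => ContextFreeRule.mk (some (p, p)) [])).union
    (Set.finite_range fun t : σ × σ × σ × X => ContextFreeRule.mk (some (t.1, t.2.2.1))
        ((h (.opening t.2.2.2)).map Symbol.terminal ++
          (Symbol.nonterminal (some (M.step t.1 (.opening t.2.2.2), t.2.1)) ::
            ((h (.closing t.2.2.2)).map Symbol.terminal ++
              [Symbol.nonterminal (some (M.step t.2.1 (.closing t.2.2.2), t.2.2.1))]))))).subset ?_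
  rintro r (⟨f, hf⟩ | ⟨p⟩ | ⟨p, q, r, x⟩)
  · exact .inl (.inl ⟨f, rfl⟩)
  · exact .inl (.inr ⟨p, rfl⟩)
  · exact .inr ⟨(p, q, r, x), rfl⟩

open ContextFreeGrammar in
theorem interpret_map_terminal_append {N : Type*} (I : N → List T → Prop) (u : List T)
    (α : List (Symbol T N)) (w : List T) :
    interpret I (u.map Symbol.terminal ++ α) w ↔ ∃ v, w = u ++ v ∧ interpret I α v := by
  induction u generalizing w with
  | nil => simp
  | cons a u ih => simp only [List.map_cons, List.cons_append, interpret, ih]; grind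

open ContextFreeGrammar in
theorem isContextFree_homImage_dyckLanguage_inf [Finite X] (h : DyckBracket X → List T)
    {R : Language (DyckBracket X)} (hR : R.IsRegular) :
    (homImage h (dyckLanguage X ⊓ R)).IsContextFree := by
  obtain ⟨σ, _, M, rfl⟩ := hR
  let G : ContextFreeGrammar T :=
    ⟨Option (σ × σ), none, (finite_setOf_dyckImageRule h M).toFinset⟩
  have hG (r : ContextFreeRule T (Option (σ × σ))) : r ∈ G.rules ↔ DyckImageRule h M r := by
    simp [G]
  -- The words that each nonterminal is meant to generate.
  let I : Option (σ × σ) → List T → Prop := fun A w =>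
    ∃ v, IsDyckWord v ∧ v.flatMap h = w ∧
      A.elim (v ∈ M.accepts) fun pq => M.evalFrom pq.1 v = pq.2
  refine ⟨G, Language.ext fun w => ?_⟩
  rw [mem_language_iff_yields]
  constructor
  · intro hw
    have hI : ∀ r ∈ G.rules, ∀ w, interpret I r.output w → I r.input w := by
      intro r hr w hw
      cases (hG r).1 hr with
      | start f hf =>
        obtain ⟨u, v, rfl, ⟨u', hu', rfl, hu⟩, rfl⟩ := hw
        refine ⟨u', hu', by simp, ?_⟩
        change M.evalFrom M.start u' ∈ M.accept
        rw [show M.evalFrom M.start u' = f from hu]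
        exact hf
      | nil p =>
        obtain rfl : w = [] := hw
        exact ⟨[], .nil, rfl, rfl⟩
      | cons p q r x =>
        obtain ⟨w₁, rfl, _, w₂, rfl, ⟨u, hu, rfl, hpq⟩, hw₂⟩ :=
          (interpret_map_terminal_append ..).1 hw
        obtain ⟨w₃, rfl, _, w₄, rfl, ⟨v, hv, rfl, hqr⟩, rfl⟩ :=
          (interpret_map_terminal_append ..).1 hw₂
        refine ⟨_, .cons_append_cons x hu hv, by simp, ?_⟩
        have h₁ : M.evalFrom (M.step p (.opening x)) u = q := hpq
        have h₂ : M.evalFrom (M.step q (.closing x)) v = r := hqr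
        change M.evalFrom p _ = r
        rw [DFA.evalFrom_cons, DFA.evalFrom_of_append, h₁, DFA.evalFrom_cons, h₂]
    obtain ⟨u, v, rfl, ⟨u', hu', rfl, hu⟩, rfl⟩ := hw.interpret hI
    exact ⟨u', ⟨hu', hu⟩, by simp⟩
  · rintro ⟨v, ⟨hv, hacc⟩, rfl⟩
    have key : ∀ p : σ, G.Yields [Symbol.nonterminal (some (p, M.evalFrom p v))] (v.flatMap h) := by
      clear hacc
      induction hv using IsDyckWord.first_return_induction with
      | nil => exact fun p => .of_rule ((hG _).2 (.nil p)) .nil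
      | cons x u v _ _ ihu ihv =>
        intro p
        rw [DFA.evalFrom_cons, DFA.evalFrom_of_append, DFA.evalFrom_cons]
        refine .of_rule ((hG _).2 (.cons p (M.evalFrom (M.step p (.opening x)) u) _ x)) ?_
        simp only [List.flatMap_cons, List.flatMap_append]
        refine yields_append.2 ⟨_, _, rfl, yields_map_terminal _, ?_⟩
        rw [← List.singleton_append]
        refine yields_append.2 ⟨_, _, rfl, ihu _, ?_⟩
        exact yields_append.2 ⟨_, _, rfl, yields_map_terminal _, ihv _⟩
    exact .of_rule ((hG _).2 (.start _ hacc)) (key M.start)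

end DyckImage

/-! ### Binary grammars and their bracket automata -/

/-- A grammar in a relaxed Chomsky normal form with nonterminals `N`. Each `π : P` is a rule
`lhs π → left π, right π`; the other rules rewrite a nonterminal to a single bracket label `x`,
which stands for the terminal word `stanleyHom [ₓ`: a letter for `x = letter a`, and the empty word for
`x = c` and `x = d`. -/
structure BinaryGrammar (T N P : Type*) where
  /-- The left-hand side of a binary rule. -/
  lhs : P → N
  /-- The first nonterminal on the right-hand side of a binary rule. -/
  left : P → N
  /-- The second nonterminal on the right-hand side of a binary rule. -/
  right : P → N
  /-- The rules that rewrite a nonterminal to a label. -/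
  leaf : N → StanleyLabel T → Prop
  /-- The initial nonterminal. -/
  root : N

/-- The label that encodes one bit: `c` encodes `false` and `d` encodes `true`. -/
def bitLabel (T : Type*) : Bool → StanleyLabel T
  | false => .c
  | true => .d

theorem bitLabel_injective (T : Type*) : Function.Injective (bitLabel T) := by
  intro a b h
  cases a <;> cases b <;> simp_all [bitLabel]

@[simp] theorem bitLabel_inj {T : Type*} {a b : Bool} : bitLabel T a = bitLabel T b ↔ a = b :=
  (bitLabel_injective T).eq_iff

@[simp] theorem stanleyHom_opening_bitLabel {T : Type*} (b : Bool) :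
    stanleyHom (.opening (bitLabel T b)) = [] := by
  cases b <;> rfl

@[simp] theorem stanleyHom_closing {T : Type*} (x : StanleyLabel T) :
    stanleyHom (.closing x) = [] := rfl

theorem bitLabel_ne_letter {T : Type*} (b : Bool) (a : T) : bitLabel T b ≠ .letter a := by
  cases b <;> simp [bitLabel]

/-- A position in the encoding of a derivation tree. The code word of `(π, false)` brackets the left
subtree of a node with rule `π`, the code word of `(π, true)` the right subtree; all code words have
length `n`. -/
inductive TreePosition (T P : Type*) (n : ℕ)
  /-- Before the first letter. -/
  | start
  /-- At letter `j` of the opening code word of `τ`. -/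
  | opening (τ : P × Bool) (j : Fin n)
  /-- At the closing partner of letter `j` of the opening code word of `τ`. -/
  | closing (τ : P × Bool) (j : Fin n)
  /-- At the opening bracket of a leaf. -/
  | leafOpening (x : StanleyLabel T)
  /-- At the closing bracket of a leaf. -/
  | leafClosing (x : StanleyLabel T)

instance (T P : Type*) (n : ℕ) [Finite T] [Finite P] : Finite (TreePosition T P n) :=
  Finite.of_surjective (fun o : Option (((P × Bool) × Fin n ⊕ (P × Bool) × Fin n) ⊕
      (StanleyLabel T ⊕ StanleyLabel T)) => match o with
      | none => TreePosition.start
      | some (.inl (.inl (τ, j))) => TreePosition.opening τ j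
      | some (.inl (.inr (τ, j))) => TreePosition.closing τ j
      | some (.inr (.inl x)) => TreePosition.leafOpening x
      | some (.inr (.inr x)) => TreePosition.leafClosing x) fun
      | .start => ⟨none, rfl⟩
      | .opening τ j => ⟨some (.inl (.inl (τ, j))), rfl⟩
      | .closing τ j => ⟨some (.inl (.inr (τ, j))), rfl⟩
      | .leafOpening x => ⟨some (.inr (.inl x)), rfl⟩
      | .leafClosing x => ⟨some (.inr (.inr x)), rfl⟩

namespace BinaryGrammar

variable {T N P : Type*} (B : BinaryGrammar T N P) {n : ℕ} (code : P × Bool → ℕ → Bool)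

/-- `B.Yields A w`: some derivation tree with root `A` has the yield `w`. -/
inductive Yields : N → List T → Prop
  | leaf {A : N} {x : StanleyLabel T} (h : B.leaf A x) : Yields A (stanleyHom (.opening x))
  | node (π : P) {u v : List T} (hu : Yields (B.left π) u) (hv : Yields (B.right π) v) :
      Yields (B.lhs π) (u ++ v)

/-- The nonterminal at the root of the subtree bracketed by the code word of `τ`. -/
def target (τ : P × Bool) : N := if τ.2 then B.right τ.1 else B.left τ.1

/-- The bracket that stands at a position, where letter `j` of the code word of `τ` is
`code τ j`. -/
def letterAt : TreePosition T P n → Option (StanleyAlphabet T)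
  | .start => none
  | .opening τ j => some (.opening (bitLabel T (code τ j)))
  | .closing τ j => some (.closing (bitLabel T (code τ j)))
  | .leafOpening x => some (.opening x)
  | .leafClosing x => some (.closing x)

/-- The first positions in the encodings of the trees with root `A`. -/
inductive Begins : N → TreePosition T P n → Prop
  | node (π : P) (j : Fin n) (hj : j.val = 0) : Begins (B.lhs π) (.opening (π, false) j)
  | leaf {A : N} {x : StanleyLabel T} (h : B.leaf A x) : Begins A (.leafOpening x)

/-- The last positions in the encodings of trees. -/
inductive Ended : TreePosition T P n → Prop
  | node (π : P) (j : Fin n) (hj : j.val = 0) : Ended (.closing (π, true) j)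
  | leaf (x : StanleyLabel T) : Ended (.leafClosing x)

/-- The pairs of neighbouring positions in encodings of trees. Neighbours do not know which code
word brackets the tree that has just ended: this is left to the Dyck property. -/
inductive Next : TreePosition T P n → TreePosition T P n → Prop
  | start {q : TreePosition T P n} (h : B.Begins B.root q) : Next .start q
  | opening (τ : P × Bool) (i j : Fin n) (h : j.val = i.val + 1) :
      Next (.opening τ i) (.opening τ j)
  | descend (τ : P × Bool) (i : Fin n) (hi : i.val + 1 = n) {q : TreePosition T P n}
      (h : B.Begins (B.target τ) q) : Next (.opening τ i) q
  | leaf {A : N} {x : StanleyLabel T} (h : B.leaf A x) : Next (.leafOpening x) (.leafClosing x)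
  | ascend {p : TreePosition T P n} (hp : Ended p) (τ : P × Bool) (j : Fin n)
      (hj : j.val + 1 = n) : Next p (.closing τ j)
  | closing (τ : P × Bool) (i j : Fin n) (h : i.val = j.val + 1) :
      Next (.closing τ i) (.closing τ j)
  | sibling (π : P) (i j : Fin n) (hi : i.val = 0) (hj : j.val = 0) :
      Next (.closing (π, false) i) (.opening (π, true) j)

/-- The automaton that recognises the sequences of brackets along neighbouring positions. -/
def automaton (n : ℕ) : NFA (StanleyAlphabet T) (TreePosition T P n) where
  step p x := {q | B.Next p q ∧ letterAt code q = some x}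
  start := {.start}
  accept := {q | Ended q}

variable {B code}

theorem mem_step_automaton {p q : TreePosition T P n} {x : StanleyAlphabet T} :
    q ∈ (B.automaton code n).step p x ↔ B.Next p q ∧ letterAt code q = some x := Iff.rfl

theorem mem_accepts_automaton {w : List (StanleyAlphabet T)} :
    w ∈ (B.automaton code n).accepts ↔ ∃ q, Ended q ∧ (B.automaton code n).Runs .start w q := by
  rw [NFA.mem_accepts_iff_runs]
  exact ⟨fun ⟨s, hs, f, hf, h⟩ => ⟨f, hf, by rwa [show s = .start from hs] at h⟩,
    fun ⟨f, hf, h⟩ => ⟨_, rfl, f, hf, h⟩⟩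

theorem nil_notMem_accepts_automaton : [] ∉ (B.automaton code n).accepts := by
  rw [mem_accepts_automaton]
  rintro ⟨q, hq, h⟩
  rw [NFA.runs_nil] at h
  subst h
  cases hq

theorem Begins.letterAt {A : N} {q : TreePosition T P n} (h : B.Begins A q) :
    ∃ x, letterAt code q = some (.opening x) := by
  cases h <;> exact ⟨_, rfl⟩

theorem Begins.cases_eq {A : N} {q : TreePosition T P n} (h : B.Begins A q) :
    (∃ π j, j.val = 0 ∧ q = .opening (π, false) j) ∨ ∃ x, B.leaf A x ∧ q = .leafOpening x := by
  cases h with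
  | node π j hj => exact .inl ⟨π, j, hj, rfl⟩
  | leaf h => exact .inr ⟨_, h, rfl⟩

theorem Next.eq_closing_of_ended {p q : TreePosition T P n} (h : B.Next p q) (hp : Ended p) :
    ∃ (τ : P × Bool) (j : Fin n), j.val + 1 = n ∧ q = .closing τ j := by
  cases hp with
  | node π j hj =>
    cases h with
    | ascend _ τ i hi => exact ⟨τ, i, hi, rfl⟩
    | closing _ _ i h => omega
  | leaf x =>
    cases h with
    | ascend _ τ i hi => exact ⟨τ, i, hi, rfl⟩

theorem Next.eq_closing_of_closing {τ : P × Bool} {j : Fin n} {q : TreePosition T P n}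
    (h : B.Next (.closing τ j) q) (hj : j.val ≠ 0) :
    ∃ i : Fin n, j.val = i.val + 1 ∧ q = .closing τ i := by
  cases h with
  | ascend hp => cases hp; contradiction
  | closing _ _ i h => exact ⟨i, h, rfl⟩
  | sibling => contradiction

/-- A Dyck word read between two positions is empty if only closing brackets can come next. -/
theorem eq_nil_of_runs {p q : TreePosition T P n} {r : List (StanleyAlphabet T)}
    (hr : IsDyckWord r) (hrun : (B.automaton code n).Runs p r q)
    (hp : ∀ q, B.Next p q → ∃ (τ : P × Bool) (j : Fin n), q = .closing τ j) : r = [] := by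
  rcases hr.exists_decomposition with rfl | ⟨x, v, r, -, -, rfl⟩
  · rfl
  obtain ⟨q', hq', -⟩ := NFA.runs_cons.1 hrun
  obtain ⟨hnext, hlet⟩ := mem_step_automaton.1 hq'
  obtain ⟨τ, j, rfl⟩ := hp _ hnext
  simp [BinaryGrammar.letterAt] at hlet

variable (B code) in
/-- The positions at which the encoding of a tree may end: either the word ends there, or the next
bracket is a closing one. -/
def Closable (q : TreePosition T P n) : Prop :=
  Ended q ∨ ∃ q' y, B.Next q q' ∧ letterAt code q' = some (.closing y)

/-- What a Dyck word read by the automaton encodes. Read inside an opening code word, it completes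
that code word and ends inside a closing code word whose remaining letters are the same; read where
a tree with root `A` has to begin, it encodes such a tree; read after a left subtree, it encodes the
right subtree together with its code words. -/
theorem dyck_run_spec
    (hcode : ∀ τ τ' : P × Bool, (∀ i < n, code τ i = code τ' i) → τ = τ')
    {u : List (StanleyAlphabet T)} (hu : IsDyckWord u) (p q : TreePosition T P n) (hne : u ≠ [])
    (hrun : (B.automaton code n).Runs p u q) (hq : B.Closable code q) :
    (∀ (τ : P × Bool) (j : Fin n), p = .opening τ j → j.val + 1 < n →
      ∃ (τ' : P × Bool) (j' : Fin n), q = .closing τ' j' ∧ j'.val = j.val + 1 ∧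
        (∀ i < n, j.val + 1 ≤ i → code τ' i = code τ i) ∧
        B.Yields (B.target τ) (u.flatMap stanleyHom)) ∧
    (∀ A, (∀ q', B.Next p q' → B.Begins A q') → Ended q ∧ B.Yields A (u.flatMap stanleyHom)) ∧
    (∀ (π : P) (j : Fin n), p = .closing (π, false) j → j.val = 0 →
      Ended q ∧ B.Yields (B.right π) (u.flatMap stanleyHom)) := by
  induction hu using IsDyckWord.first_return_induction generalizing p q with
  | nil => contradiction
  | cons x v r hv hr ihv ihr =>
  obtain ⟨q₀, hq₀, hrun⟩ := NFA.runs_cons.1 hrun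
  obtain ⟨q₁, hrunv, hrun⟩ := NFA.runs_append.1 hrun
  obtain ⟨q₂, hq₂, hrunr⟩ := NFA.runs_cons.1 hrun
  rw [mem_step_automaton] at hq₀ hq₂
  have hq₁ : B.Closable code q₁ := .inr ⟨q₂, x, hq₂⟩
  -- The bracket pair around `v` belongs to code words that agree from there on.
  have inner (τ : P × Bool) (j : Fin n) (h₀ : q₀ = .opening τ j) :
      ∃ τ' : P × Bool, q₂ = .closing τ' j ∧ (∀ i < n, j.val ≤ i → code τ' i = code τ i) ∧
        B.Yields (B.target τ) (v.flatMap stanleyHom) := by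
    subst h₀
    have hx : bitLabel T (code τ j) = x := by simpa [letterAt] using hq₀.2
    have hvne : v ≠ [] := by
      rintro rfl
      rw [NFA.runs_nil] at hrunv
      subst hrunv
      obtain ⟨hnext, hlet⟩ := hq₂
      cases hnext with
      | opening => simp [letterAt] at hlet
      | descend _ _ _ h =>
        obtain ⟨y, hy⟩ := h.letterAt (code := code)
        simp [hy] at hlet
      | ascend hp => cases hp
    by_cases hj : j.val + 1 < n
    · obtain ⟨τ', j', rfl, hj', hagree, hy⟩ := (ihv _ _ hvne hrunv hq₁).1 τ j rfl hj
      obtain ⟨i, hi, rfl⟩ := hq₂.1.eq_closing_of_closing (by omega)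
      obtain rfl : i = j := Fin.ext (by omega)
      have hx' : bitLabel T (code τ' i) = x := by simpa [letterAt] using hq₂.2
      refine ⟨τ', rfl, fun l hl hjl => ?_, hy⟩
      rcases hjl.eq_or_lt with rfl | hlt
      · exact bitLabel_injective T (hx'.trans hx.symm)
      · exact hagree l hl hlt
    · have hj' : j.val + 1 = n := by omega
      obtain ⟨hend, hy⟩ := (ihv _ _ hvne hrunv hq₁).2.1 (B.target τ) fun q' hq' => by
        cases hq' with
        | opening => omega
        | descend _ _ _ h => exact h
        | ascend hp => cases hp
      obtain ⟨τ', i, hi, rfl⟩ := hq₂.1.eq_closing_of_ended hend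
      obtain rfl : i = j := Fin.ext (by omega)
      have hx' : bitLabel T (code τ' i) = x := by simpa [letterAt] using hq₂.2
      refine ⟨τ', rfl, fun l hl hjl => ?_, hy⟩
      obtain rfl : l = i.val := by omega
      exact bitLabel_injective T (hx'.trans hx.symm)
  refine ⟨?_, ?_, ?_⟩
  · rintro τ j rfl hj
    obtain ⟨j', hj', rfl⟩ : ∃ j' : Fin n, j'.val = j.val + 1 ∧ q₀ = .opening τ j' := by
      cases hq₀.1 with
      | opening _ _ j' h => exact ⟨j', h, rfl⟩
      | descend => omega
      | ascend hp => cases hp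
    obtain ⟨τ', rfl, hagree, hy⟩ := inner τ j' rfl
    obtain rfl : r = [] := eq_nil_of_runs hr hrunr fun q' hq' => by
      obtain ⟨i, -, rfl⟩ := hq'.eq_closing_of_closing (by omega)
      exact ⟨_, _, rfl⟩
    rw [NFA.runs_nil] at hrunr
    have hx : bitLabel T (code τ j') = x := by simpa [letterAt] using hq₀.2
    refine ⟨τ', j', hrunr, hj', fun i hi hji => hagree i hi (by omega), ?_⟩
    simpa [← hx] using hy
  · intro A hA
    cases hA q₀ hq₀.1 with
    | node π j hj =>
      obtain ⟨τ', rfl, hagree, hy⟩ := inner _ j rfl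
      obtain rfl : τ' = (π, false) := hcode _ _ fun i hi => hagree i hi (by omega)
      have hrne : r ≠ [] := by
        rintro rfl
        rw [NFA.runs_nil] at hrunr
        subst hrunr
        rcases hq with hq | ⟨q', y, hnext, hlet⟩
        · cases hq
        · cases hnext with
          | ascend hp => cases hp
          | closing => omega
          | sibling => simp [letterAt] at hlet
      obtain ⟨hend, hy'⟩ := (ihr _ _ hrne hrunr hq).2.2 π j rfl hj
      have hx : bitLabel T (code (π, false) j) = x := by simpa [letterAt] using hq₀.2
      refine ⟨hend, ?_⟩
      simpa [← hx] using Yields.node π hy hy'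
    | @leaf _ y h =>
      have hx : y = x := by simpa [letterAt] using hq₀.2
      subst hx
      have hleaf (q' : TreePosition T P n) (h : B.Next (.leafOpening y) q') :
          q' = .leafClosing y := by
        cases h with
        | leaf => rfl
        | ascend hp => cases hp
      obtain rfl : v = [] := by
        rcases hv.exists_decomposition with rfl | ⟨z, v₁, v₂, -, -, rfl⟩
        · rfl
        obtain ⟨q', hq', -⟩ := NFA.runs_cons.1 hrunv
        obtain ⟨hnext, hlet⟩ := mem_step_automaton.1 hq'
        rw [hleaf _ hnext] at hlet
        simp [letterAt] at hlet
      rw [NFA.runs_nil] at hrunv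
      subst hrunv
      obtain rfl := hleaf _ hq₂.1
      obtain rfl : r = [] := eq_nil_of_runs hr hrunr fun q' hq' => by
        obtain ⟨τ, i, -, rfl⟩ := hq'.eq_closing_of_ended (.leaf _)
        exact ⟨_, _, rfl⟩
      rw [NFA.runs_nil] at hrunr
      subst hrunr
      exact ⟨.leaf _, by simpa using Yields.leaf h⟩
  · rintro π j rfl hj
    obtain ⟨j', hj', rfl⟩ : ∃ j' : Fin n, j'.val = 0 ∧ q₀ = .opening (π, true) j' := by
      cases hq₀.1 with
      | ascend hp => cases hp
      | closing => omega
      | sibling _ _ j' _ h => exact ⟨j', h, rfl⟩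
    obtain ⟨τ', rfl, hagree, hy⟩ := inner _ j' rfl
    obtain rfl : τ' = (π, true) := hcode _ _ fun i hi => hagree i hi (by omega)
    obtain rfl : r = [] := eq_nil_of_runs hr hrunr fun q' hq' => by
      obtain ⟨τ, i, -, rfl⟩ := hq'.eq_closing_of_ended (.node π j' hj')
      exact ⟨_, _, rfl⟩
    rw [NFA.runs_nil] at hrunr
    have hx : bitLabel T (code (π, true) j') = x := by simpa [letterAt] using hq₀.2
    refine ⟨hrunr ▸ .node π j' hj', ?_⟩
    simpa [← hx, target] using hy

/-- The labels of the letters of the opening code word of `τ`. -/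
def codeWord (T : Type*) (n : ℕ) (code : P × Bool → ℕ → Bool) (τ : P × Bool) :
    List (StanleyLabel T) :=
  List.ofFn fun j : Fin n => bitLabel T (code τ j)

@[simp] theorem flatMap_codeWord_opening (τ : P × Bool) :
    ((codeWord T n code τ).map DyckBracket.opening).flatMap stanleyHom = [] := by
  simp [codeWord, List.flatMap_eq_nil_iff]

@[simp] theorem flatMap_codeWord_closing (τ : P × Bool) :
    ((codeWord T n code τ).map DyckBracket.closing).reverse.flatMap stanleyHom = [] := by
  simp [codeWord, List.flatMap_eq_nil_iff]

theorem runs_opening_codeWord (hn : 0 < n) {p : TreePosition T P n} {τ : P × Bool}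
    (h : B.Next p (.opening τ ⟨0, hn⟩)) :
    (B.automaton code n).Runs p ((codeWord T n code τ).map DyckBracket.opening)
      (.opening τ ⟨n - 1, by omega⟩) := by
  rw [NFA.runs_iff_exists_seq]
  refine ⟨fun i => if i = 0 then p else .opening τ ⟨min (i - 1) (n - 1), by omega⟩, rfl, ?_, ?_⟩
  · simp [codeWord, hn.ne']
  · intro i hi
    have hi' : i < n := by simpa [codeWord] using hi
    have hmin : min i (n - 1) = i := by omega
    refine mem_step_automaton.2 ⟨?_, by simp [letterAt, codeWord, hmin]⟩
    rcases i with _ | i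
    · simpa using h
    · simp only [Nat.add_eq_zero_iff, one_ne_zero, and_false, if_false]
      exact .opening _ _ _ (by simp; omega)

theorem runs_closing_codeWord (hn : 0 < n) {p : TreePosition T P n} (τ : P × Bool)
    (h : Ended p) :
    (B.automaton code n).Runs p ((codeWord T n code τ).map DyckBracket.closing).reverse
      (.closing τ ⟨0, hn⟩) := by
  rw [NFA.runs_iff_exists_seq]
  refine ⟨fun i => if i = 0 then p else .closing τ ⟨n - 1 - (i - 1), by omega⟩, rfl, ?_, ?_⟩
  · simp [codeWord, hn.ne']
  · intro i hi
    have hi' : i < n := by simpa [codeWord] using hi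
    refine mem_step_automaton.2 ⟨?_, by simp [letterAt, codeWord]⟩
    rcases i with _ | i
    · exact .ascend h _ _ (by simp; omega)
    · simp only [Nat.add_eq_zero_iff, one_ne_zero, and_false, if_false]
      exact .closing _ _ _ (by simp; omega)

/-- Every derivation tree has an encoding, which can be read wherever the tree may begin. -/
theorem Yields.exists_dyckWord (hn : 0 < n) {A : N} {w : List T} (h : B.Yields A w) :
    ∃ u, IsDyckWord u ∧ u.flatMap stanleyHom = w ∧
      ∀ p : TreePosition T P n, (∀ q, B.Begins A q → B.Next p q) →
        ∃ q, Ended q ∧ (B.automaton code n).Runs p u q := by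
  induction h with
  | @leaf A x h =>
    refine ⟨[.opening x, .closing x], .nest x [] .nil, by simp, fun p hp => ?_⟩
    refine ⟨.leafClosing x, .leaf x, NFA.runs_cons.2 ⟨.leafOpening x, ?_, ?_⟩⟩
    · exact mem_step_automaton.2 ⟨hp _ (.leaf h), rfl⟩
    · exact NFA.runs_singleton.2 (mem_step_automaton.2 ⟨.leaf h, rfl⟩)
  | @node π u v _ _ ihu ihv =>
    obtain ⟨u', hu', rfl, hru⟩ := ihu
    obtain ⟨v', hv', rfl, hrv⟩ := ihv
    refine ⟨_, .append _ _ (hu'.wrap (codeWord T n code (π, false)))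
      (hv'.wrap (codeWord T n code (π, true))), ?_, fun p hp => ?_⟩
    · simp only [List.flatMap_append, flatMap_codeWord_opening, flatMap_codeWord_closing,
        List.nil_append, List.append_nil]
    -- A subtree is read together with the code words that bracket it.
    have wrapped (τ : P × Bool) (w : List (StanleyAlphabet T)) (p : TreePosition T P n)
        (hp : B.Next p (.opening τ ⟨0, hn⟩))
        (hw : ∀ p : TreePosition T P n, (∀ q, B.Begins (B.target τ) q → B.Next p q) →
          ∃ q, Ended q ∧ (B.automaton code n).Runs p w q) :
        (B.automaton code n).Runs p ((codeWord T n code τ).map .opening ++ w ++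
          ((codeWord T n code τ).map .closing).reverse) (.closing τ ⟨0, hn⟩) := by
      obtain ⟨q, hq, hrun⟩ := hw (.opening τ ⟨n - 1, by omega⟩)
        fun q hq => .descend _ _ (by simp; omega) hq
      exact NFA.runs_append.2 ⟨q, NFA.runs_append.2 ⟨_, runs_opening_codeWord hn hp, hrun⟩,
        runs_closing_codeWord hn τ hq⟩
    refine ⟨.closing (π, true) ⟨0, hn⟩, .node _ _ rfl, NFA.runs_append.2
      ⟨.closing (π, false) ⟨0, hn⟩, wrapped _ _ _ (hp _ (.node _ _ rfl)) hru,
        wrapped _ _ _ (.sibling _ _ _ rfl rfl) hrv⟩⟩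

/-- The Chomsky–Schützenberger theorem for binary grammars and the alphabet of Stanley. -/
theorem mem_homImage_iff_yields (hn : 0 < n)
    (hcode : ∀ τ τ' : P × Bool, (∀ i < n, code τ i = code τ' i) → τ = τ') {w : List T} :
    w ∈ homImage stanleyHom (dyckLanguage (StanleyLabel T) ⊓ (B.automaton code n).accepts) ↔
      B.Yields B.root w := by
  constructor
  · rintro ⟨u, ⟨hu, hacc⟩, rfl⟩
    have hne : u ≠ [] := fun h => nil_notMem_accepts_automaton (h ▸ hacc)
    obtain ⟨q, hq, hrun⟩ := mem_accepts_automaton.1 hacc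
    refine ((dyck_run_spec hcode hu _ _ hne hrun (.inl hq)).2.1 B.root fun q' hq' => ?_).2
    cases hq' with
    | start h => exact h
    | ascend hp => cases hp
  · intro h
    obtain ⟨u, hu, rfl, hrun⟩ := h.exists_dyckWord (code := code) hn
    obtain ⟨q, hq, hq'⟩ := hrun .start fun q hq => .start hq
    exact ⟨u, ⟨hu, mem_accepts_automaton.2 ⟨q, hq, hq'⟩⟩, rfl⟩

end BinaryGrammar

/-! ### Synchronisation of runs -/

namespace BinaryGrammar

variable {T N P : Type*} {B : BinaryGrammar T N P} {n : ℕ} {code : P × Bool → ℕ → Bool}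

/-- Code words of length `n` that can be located inside a run of opening (or closing) brackets: the
factor `cc` occurs in them at the very beginning only, and the last letter is `d`. -/
structure IsSynchronizing (n : ℕ) (code : P × Bool → ℕ → Bool) : Prop where
  two_le : 2 ≤ n
  injective : ∀ τ τ' : P × Bool, (∀ i < n, code τ i = code τ' i) → τ = τ'
  zero (τ : P × Bool) : code τ 0 = false
  one (τ : P × Bool) : code τ 1 = false
  last (τ : P × Bool) : code τ (n - 1) = true
  eq_zero (τ : P × Bool) (i : ℕ) (hi : i + 1 < n) (h : code τ i = false)
    (h' : code τ (i + 1) = false) : i = 0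

/-- Inside a closing code word, the positions along a run count down. -/
theorem closing_add {ρ : ℕ → TreePosition T P n} {m : ℕ}
    (hnext : ∀ i < m, B.Next (ρ i) (ρ (i + 1)))
    {i : ℕ} {τ : P × Bool} {j : Fin n} (hi : ρ i = .closing τ j) (d : ℕ)
    (hd : d ≤ j.val) (hm : i + d ≤ m) :
    ρ (i + d) = .closing τ ⟨j.val - d, by omega⟩ := by
  induction d with
  | zero => simpa using hi
  | succ d ih =>
    have h := hnext (i + d) (by omega)
    rw [ih (by omega) (by omega)] at h
    obtain ⟨l, hl, hρ⟩ := h.eq_closing_of_closing (by simp; omega)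
    rw [← Nat.add_assoc, hρ]
    congr 1
    exact Fin.ext (by simp at hl ⊢; omega)

/-- Inside an opening code word, the positions along a run count up. -/
theorem opening_add {ρ : ℕ → TreePosition T P n} {m : ℕ}
    (hnext : ∀ i < m, B.Next (ρ i) (ρ (i + 1))) {i : ℕ} {τ : P × Bool} {j : Fin n}
    (hi : ρ i = .opening τ j) (d : ℕ) (hd : j.val + d < n) (hm : i + d ≤ m) :
    ρ (i + d) = .opening τ ⟨j.val + d, hd⟩ := by
  induction d with
  | zero => simpa using hi
  | succ d ih =>
    have h := hnext (i + d) (by omega)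
    rw [ih (by omega) (by omega)] at h
    rw [← Nat.add_assoc]
    generalize ρ (i + d + 1) = q at h
    cases h with
    | opening _ _ l hl =>
      congr 1
      exact Fin.ext (by simp at hl ⊢; omega)
    | descend _ _ hl => simp at hl; omega
    | ascend hp => cases hp

/-- Two runs that read the same `2 n + 2` closing brackets of code words are both at the end of a
tree at some moment: one of them completes a code word, and its last two letters `c'c'` force the
other one to do so as well. -/
theorem exists_ended_of_closing (hs : IsSynchronizing n code) {ρ ρ' : ℕ → TreePosition T P n}
    (hnext : ∀ i < 2 * n + 2, B.Next (ρ i) (ρ (i + 1)))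
    (hnext' : ∀ i < 2 * n + 2, B.Next (ρ' i) (ρ' (i + 1)))
    (hlet : ∀ i, 1 ≤ i → i ≤ 2 * n + 2 → letterAt code (ρ i) = letterAt code (ρ' i))
    (hcl : ∀ i, 1 ≤ i → i ≤ 2 * n + 2 → ∃ τ j, ρ i = .closing τ j)
    (hcl' : ∀ i, 1 ≤ i → i ≤ 2 * n + 2 → ∃ τ j, ρ' i = .closing τ j) :
    ∃ i, 1 ≤ i ∧ i < 2 * n + 2 ∧ Ended (ρ i) ∧ Ended (ρ' i) := by
  have hn := hs.two_le
  -- A position at which a code word has been read and a closing bracket follows ends a tree.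
  have ended_of {σ : ℕ → TreePosition T P n} (hσ : ∀ i < 2 * n + 2, B.Next (σ i) (σ (i + 1)))
      (hclσ : ∀ i, 1 ≤ i → i ≤ 2 * n + 2 → ∃ τ j, σ i = .closing τ j) {i : ℕ}
      (hi : i < 2 * n + 2) {τ : P × Bool} {j : Fin n} (hj : j.val = 0) (h : σ i = .closing τ j) :
      Ended (σ i) := by
    obtain ⟨τ', j', h'⟩ := hclσ (i + 1) (by omega) (by omega)
    have hstep := hσ i hi
    rw [h'] at hstep
    rw [h] at hstep ⊢
    cases hstep with
    | ascend hp => exact hp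
    | closing => omega
  obtain ⟨τ₁, j₁, h₁⟩ := hcl 1 le_rfl (by omega)
  have h₂ := closing_add hnext h₁ j₁.val le_rfl (by omega)
  have hend := ended_of hnext hcl (by omega) (by simp) h₂
  obtain ⟨τ, j, hj, h₃⟩ := (hnext (1 + j₁.val) (by omega)).eq_closing_of_ended hend
  have h₄ := closing_add hnext h₃ (n - 2) (by omega) (by omega)
  have h₅ := closing_add hnext h₃ (n - 1) (by omega) (by omega)
  set t := 1 + j₁.val + 1 + (n - 2) with ht
  have ht' : 1 + j₁.val + 1 + (n - 1) = t + 1 := by omega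
  rw [ht'] at h₅
  refine ⟨t + 1, by omega, by omega, ended_of hnext hcl (by omega) (by simp; omega) h₅, ?_⟩
  obtain ⟨τ', i, h₆⟩ := hcl' t (by omega) (by omega)
  obtain ⟨τ'', i', h₇⟩ := hcl' (t + 1) (by omega) (by omega)
  have hc : code τ' i = false := by
    have h := hlet t (by omega) (by omega)
    have hval : j.val - (n - 2) = 1 := by omega
    simpa [h₄, h₆, letterAt, hval, hs.one] using h.symm
  have hc' : code τ'' i' = false := by
    have h := hlet (t + 1) (by omega) (by omega)
    have hval : j.val - (n - 1) = 0 := by omega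
    simpa [h₅, h₇, letterAt, hval, hs.zero] using h.symm
  refine ended_of hnext' hcl' (by omega) ?_ h₇
  have hstep := hnext' t (by omega)
  rw [h₆, h₇] at hstep
  cases hstep with
  | ascend hp _ _ hl =>
    rw [show i'.val = n - 1 by omega, hs.last] at hc'
    cases hc'
  | closing _ _ _ hl =>
    have := hs.eq_zero τ' i' (by omega) hc' (by rwa [← hl])
    exact this

/-- Two runs that read the same `2 n` opening brackets of code words coincide at some moment: the
factor `cc` shows where the code words start, and a whole code word determines the position. -/
theorem exists_eq_of_opening (hs : IsSynchronizing n code) {ρ ρ' : ℕ → TreePosition T P n} {s m : ℕ}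
    (hm : s + 2 * n - 1 ≤ m)
    (hnext : ∀ i < m, B.Next (ρ i) (ρ (i + 1)))
    (hnext' : ∀ i < m, B.Next (ρ' i) (ρ' (i + 1)))
    (hlet : ∀ i, s ≤ i → i ≤ m → letterAt code (ρ i) = letterAt code (ρ' i))
    (hop : ∀ i, s ≤ i → i ≤ m → ∃ τ j, ρ i = .opening τ j)
    (hop' : ∀ i, s ≤ i → i ≤ m → ∃ τ j, ρ' i = .opening τ j) :
    ∃ i, s ≤ i ∧ i ≤ m ∧ ρ i = ρ' i := by
  have hn := hs.two_le
  obtain ⟨τ₁, j₁, h₁⟩ := hop s le_rfl (by omega)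
  have h₂ := opening_add hnext h₁ (n - 1 - j₁.val) (by omega) (by omega)
  obtain ⟨t, ht⟩ : ∃ t, t = s + (n - 1 - j₁.val) + 1 := ⟨_, rfl⟩
  obtain ⟨τ, j, hj, h₃⟩ : ∃ (τ : P × Bool) (j : Fin n), j.val = 0 ∧ ρ t = .opening τ j := by
    obtain ⟨τ, j, h₃⟩ := hop t (by omega) (by omega)
    have hstep := hnext (s + (n - 1 - j₁.val)) (by omega)
    rw [h₂, ← ht, h₃] at hstep
    refine ⟨τ, j, ?_, h₃⟩
    cases hstep with
    | opening _ _ _ h => simp at h; omega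
    | descend _ _ _ h =>
      rcases h.cases_eq with ⟨_, _, hj, heq⟩ | ⟨_, _, heq⟩ <;> cases heq
      exact hj
  obtain ⟨τ', i, h₄⟩ := hop' t (by omega) (by omega)
  obtain ⟨τ'', i', h₅⟩ := hop' (t + 1) (by omega) (by omega)
  have h₆ := opening_add hnext h₃ 1 (by omega) (by omega)
  have hc : code τ' i = false := by
    have h := hlet t (by omega) (by omega)
    simpa [h₃, h₄, letterAt, hj, hs.zero] using h.symm
  have hc' : code τ'' i' = false := by
    have h := hlet (t + 1) (by omega) (by omega)
    simpa [h₆, h₅, letterAt, hj, hs.one] using h.symm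
  have hi : i.val = 0 := by
    have hstep := hnext' t (by omega)
    rw [h₄, h₅] at hstep
    cases hstep with
    | opening _ _ _ h => exact hs.eq_zero τ' i (by omega) hc (by rwa [← h])
    | descend _ _ h =>
      rw [show i.val = n - 1 by omega, hs.last] at hc
      cases hc
  have hτ : τ = τ' := hs.injective _ _ fun l hl => by
    have h := hlet (t + l) (by omega) (by omega)
    rw [opening_add hnext h₃ l (by omega) (by omega),
      opening_add hnext' h₄ l (by omega) (by omega)] at h
    simpa [letterAt, hj, hi] using h
  have hij : i = j := Fin.ext (by omega)
  exact ⟨t, by omega, by omega, by rw [h₃, h₄, hτ, hij]⟩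

/-- Two runs over a common word of length `4 n + 1` pass a common position, or end a tree
simultaneously. -/
theorem exists_sync (hs : IsSynchronizing n code)
    (hleaf : ∀ A x, B.leaf A x → ∃ a, x = .letter a) {ρ ρ' : ℕ → TreePosition T P n}
    (hnext : ∀ i < 4 * n + 1, B.Next (ρ i) (ρ (i + 1)))
    (hnext' : ∀ i < 4 * n + 1, B.Next (ρ' i) (ρ' (i + 1)))
    (hlet : ∀ i, 1 ≤ i → i ≤ 4 * n + 1 → letterAt code (ρ i) = letterAt code (ρ' i)) :
    ∃ i, 1 ≤ i ∧ i ≤ 4 * n + 1 ∧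
      (ρ i = ρ' i ∨ i < 4 * n + 1 ∧ Ended (ρ i) ∧ Ended (ρ' i)) := by
  by_contra! hcon
  have hn := hs.two_le
  -- A leaf is visible in the word, so both runs only visit code words.
  have hkind {p q q' r : TreePosition T P n} (hq : B.Next p q) (hr : B.Next r q')
      (h : letterAt code q = letterAt code q') (hne : q ≠ q') :
      (∃ τ j τ' j', q = .opening τ j ∧ q' = .opening τ' j') ∨
      (∃ τ j τ' j', q = .closing τ j ∧ q' = .closing τ' j') := by
    have hletter {p q : TreePosition T P n} (hq : B.Next p q) (x : StanleyLabel T)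
        (h : q = .leafOpening x ∨ q = .leafClosing x) : ∃ a, x = .letter a := by
      rcases h with rfl | rfl
      · cases hq with
        | start h | descend _ _ _ h =>
          rcases h.cases_eq with ⟨_, _, _, heq⟩ | ⟨_, h, heq⟩ <;> cases heq
          exact hleaf _ _ h
      · cases hq with
        | start h | descend _ _ _ h =>
          rcases h.cases_eq with ⟨_, _, _, heq⟩ | ⟨_, _, heq⟩ <;> cases heq
        | leaf h => exact hleaf _ _ h
    have hstart {p : TreePosition T P n} : ¬ B.Next p .start := by
      intro h
      cases h with
      | start h | descend _ _ _ h =>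
        rcases h.cases_eq with ⟨_, _, _, heq⟩ | ⟨_, _, heq⟩ <;> cases heq
    cases q with
    | start => exact absurd hq hstart
    | opening τ j =>
      cases q' with
      | opening τ' j' => exact .inl ⟨_, _, _, _, rfl, rfl⟩
      | leafOpening x =>
        obtain ⟨a, rfl⟩ := hletter hr x (.inl rfl)
        simp [letterAt, bitLabel_ne_letter] at h
      | _ => simp [letterAt] at h
    | closing τ j =>
      cases q' with
      | closing τ' j' => exact .inr ⟨_, _, _, _, rfl, rfl⟩
      | leafClosing x =>
        obtain ⟨a, rfl⟩ := hletter hr x (.inr rfl)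
        simp [letterAt, bitLabel_ne_letter] at h
      | _ => simp [letterAt] at h
    | leafOpening x =>
      obtain ⟨a, rfl⟩ := hletter hq x (.inl rfl)
      cases q' with
      | opening τ' j' => simp [letterAt, (bitLabel_ne_letter _ _).symm] at h
      | leafOpening x => simp [letterAt] at h; simp [h] at hne
      | _ => simp [letterAt] at h
    | leafClosing x =>
      obtain ⟨a, rfl⟩ := hletter hq x (.inr rfl)
      cases q' with
      | closing τ' j' => simp [letterAt, (bitLabel_ne_letter _ _).symm] at h
      | leafClosing x => simp [letterAt] at h; simp [h] at hne
      | _ => simp [letterAt] at h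
  have hdich (i : ℕ) (h₁ : 1 ≤ i) (h₂ : i ≤ 4 * n + 1) :
      (∃ τ j τ' j', ρ i = .opening τ j ∧ ρ' i = .opening τ' j') ∨
      (∃ τ j τ' j', ρ i = .closing τ j ∧ ρ' i = .closing τ' j') := by
    obtain ⟨i, rfl⟩ : ∃ l, i = l + 1 := ⟨i - 1, by omega⟩
    exact hkind (hnext i (by omega)) (hnext' i (by omega)) (hlet _ h₁ h₂) (hcon _ h₁ h₂).1
  have hmono (i : ℕ) (h₂ : i < 4 * n + 1) {τ : P × Bool} {j : Fin n}
      (h : ρ i = .opening τ j) {τ' : P × Bool} {j' : Fin n} : ρ (i + 1) ≠ .closing τ' j' := by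
    intro h'
    have hstep := hnext i h₂
    rw [h, h'] at hstep
    cases hstep with
    | descend _ _ _ h => rcases h.cases_eq with ⟨_, _, _, heq⟩ | ⟨_, _, heq⟩ <;> cases heq
    | ascend hp => cases hp
  rcases hdich (2 * n + 2) (by omega) (by omega) with
    ⟨τ, j, τ', j', h, h'⟩ | ⟨τ, j, τ', j', h, h'⟩
  · have hop (d : ℕ) (hd : 2 * n + 2 + d ≤ 4 * n + 1) :
        ∃ τ j τ' j', ρ (2 * n + 2 + d) = .opening τ j ∧ ρ' (2 * n + 2 + d) = .opening τ' j' := by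
      induction d with
      | zero => exact ⟨τ, j, τ', j', h, h'⟩
      | succ d ih =>
        obtain ⟨_, _, _, _, h₁, -⟩ := ih (by omega)
        rcases hdich (2 * n + 2 + (d + 1)) (by omega) hd with h | ⟨_, _, _, _, h₂, -⟩
        · exact h
        · exact absurd h₂ (hmono _ (by omega) h₁)
    have hop' (i : ℕ) (h₁ : 2 * n + 2 ≤ i) (h₂ : i ≤ 4 * n + 1) :
        ∃ τ j τ' j', ρ i = .opening τ j ∧ ρ' i = .opening τ' j' := by
      obtain ⟨d, rfl⟩ := Nat.exists_eq_add_of_le h₁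
      exact hop d h₂
    obtain ⟨i, h₁, h₂, heq⟩ := exists_eq_of_opening (s := 2 * n + 2) (m := 4 * n + 1) hs (by omega)
      hnext hnext' (fun i h₁ h₂ => hlet i (by omega) h₂)
      (fun i h₁ h₂ => let ⟨τ, j, _, _, h, _⟩ := hop' i h₁ h₂; ⟨τ, j, h⟩)
      (fun i h₁ h₂ => let ⟨_, _, τ, j, _, h⟩ := hop' i h₁ h₂; ⟨τ, j, h⟩)
    exact (hcon i (by omega) h₂).1 heq
  · have hcl (d : ℕ) (hd : d ≤ 2 * n + 1) :
        ∃ τ j τ' j', ρ (2 * n + 2 - d) = .closing τ j ∧ ρ' (2 * n + 2 - d) = .closing τ' j' := by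
      induction d with
      | zero => exact ⟨τ, j, τ', j', h, h'⟩
      | succ d ih =>
        obtain ⟨_, _, _, _, h₁, -⟩ := ih (by omega)
        rcases hdich (2 * n + 2 - (d + 1)) (by omega) (by omega) with ⟨_, _, _, _, h₂, -⟩ | h
        · rw [show 2 * n + 2 - d = 2 * n + 2 - (d + 1) + 1 by omega] at h₁
          exact absurd h₁ (hmono _ (by omega) h₂)
        · exact h
    have hcl' (i : ℕ) (h₁ : 1 ≤ i) (h₂ : i ≤ 2 * n + 2) :
        ∃ τ j τ' j', ρ i = .closing τ j ∧ ρ' i = .closing τ' j' := by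
      have := hcl (2 * n + 2 - i) (by omega)
      rwa [Nat.sub_sub_self h₂] at this
    obtain ⟨i, h₁, h₂, hend, hend'⟩ := exists_ended_of_closing hs
      (fun i hi => hnext i (by omega)) (fun i hi => hnext' i (by omega))
      (fun i h₁ h₂ => hlet i h₁ (by omega))
      (fun i h₁ h₂ => let ⟨τ, j, _, _, h, _⟩ := hcl' i h₁ h₂; ⟨τ, j, h⟩)
      (fun i h₁ h₂ => let ⟨_, _, τ, j, _, h⟩ := hcl' i h₁ h₂; ⟨τ, j, h⟩)
    exact (hcon i h₁ (by omega)).2 (by omega) hend hend'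

theorem isSLT_accepts_automaton [Finite T] (hs : IsSynchronizing n code)
    (hleaf : ∀ A x, B.leaf A x → ∃ a, x = .letter a) :
    IsSLT (4 * n + 2) (B.automaton code n).accepts := by
  refine NFA.isSLT_accepts (by omega) nil_notMem_accepts_automaton fun w p p' q q' hw h h' => ?_
  obtain ⟨ρ, rfl, -, hρ⟩ := NFA.runs_iff_exists_seq.1 h
  obtain ⟨ρ', -, rfl, hρ'⟩ := NFA.runs_iff_exists_seq.1 h'
  have hw' : w.length = 4 * n + 1 := by omega
  obtain ⟨t, ht, hcross⟩ : ∃ t, t < w.length ∧ B.Next (ρ t) (ρ' (t + 1)) := by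
    obtain ⟨i, h₁, h₂, hi⟩ := exists_sync (ρ := ρ) (ρ' := ρ') hs hleaf
      (fun i hi => (hρ i (by omega)).1) (fun i hi => (hρ' i (by omega)).1) (fun i h₁ h₂ => by
        obtain ⟨i, rfl⟩ : ∃ l, i = l + 1 := ⟨i - 1, by omega⟩
        exact (hρ i (by omega)).2.trans (hρ' i (by omega)).2.symm)
    rcases hi with heq | ⟨hi, hend, hend'⟩
    · obtain ⟨i, rfl⟩ : ∃ l, i = l + 1 := ⟨i - 1, by omega⟩
      exact ⟨i, by omega, heq ▸ (hρ i (by omega)).1⟩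
    · obtain ⟨τ, j, hj, h⟩ := (hρ' i (by omega)).1.eq_closing_of_ended hend'
      exact ⟨i, by omega, h ▸ .ascend hend τ j hj⟩
  refine NFA.runs_iff_exists_seq.2 ⟨fun i => if i ≤ t then ρ i else ρ' i, by simp, ?_, ?_⟩
  · simp [ht]
  · intro i hi
    rcases lt_trichotomy i t with hit | rfl | hit
    · simpa [hit.le, Nat.succ_le_of_lt hit] using hρ i hi
    · simpa using mem_step_automaton.2 ⟨hcross, (hρ' i hi).2⟩
    · simpa [hit.not_ge, show ¬ i + 1 ≤ t by omega] using hρ' i hi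

end BinaryGrammar

/-! ### A synchronizing code of logarithmic length -/

/-- The code word `cc d b₀ d b₁ … d bₘ₋₁ d` of the number `e` with the binary digits `bᵢ`, where
`false` stands for `c` and `true` for `d`. -/
def binaryCode (e j : ℕ) : Bool :=
  if j = 0 then false else if j % 2 = 0 then true else if j = 1 then false
    else e.testBit (j / 2 - 1)

theorem binaryCode_injOn {m e e' : ℕ} (he : e < 2 ^ m) (he' : e' < 2 ^ m)
    (h : ∀ j < 2 * m + 3, binaryCode e j = binaryCode e' j) : e = e' := by
  refine Nat.eq_of_testBit_eq fun i => ?_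
  by_cases hi : i < m
  · have hbit (e : ℕ) : binaryCode e (2 * i + 3) = e.testBit i := by
      simp only [binaryCode]
      rw [if_neg (by omega), if_neg (by omega), if_neg (by omega)]
      congr 1
      omega
    rw [← hbit, ← hbit, h _ (by omega)]
  · have hle : 2 ^ m ≤ 2 ^ i := Nat.pow_le_pow_right (by norm_num) (by omega)
    rw [Nat.testBit_lt_two_pow (by omega), Nat.testBit_lt_two_pow (by omega)]

theorem BinaryGrammar.exists_isSynchronizing {P : Type*} [Finite P] {m : ℕ}
    (hm : 2 * Nat.card P ≤ 2 ^ m) :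
    ∃ code : P × Bool → ℕ → Bool, IsSynchronizing (2 * m + 3) code := by
  let e := Finite.equivFin (P × Bool)
  have he (τ : P × Bool) : (e τ : ℕ) < 2 ^ m := by
    have h : Nat.card (P × Bool) = 2 * Nat.card P := by simp [Nat.card_prod, mul_comm]
    exact (e τ).isLt.trans_le (h.trans_le hm)
  refine ⟨fun τ => binaryCode (e τ), by omega, fun τ τ' h => ?_, fun τ => rfl, fun τ => rfl,
    fun τ => ?_, fun τ i hi h h' => ?_⟩
  · exact e.injective (Fin.ext (binaryCode_injOn (he τ) (he τ') h))
  · simp only [binaryCode]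
    rw [if_neg (by omega), if_pos (by omega)]
  · -- One of two neighbouring positions is even, and hence holds `true` unless it is `0`.
    simp only [binaryCode] at h h'
    by_contra hne
    rcases Nat.even_or_odd' i with ⟨l, rfl | rfl⟩
    · rw [if_neg hne, if_pos (by omega)] at h
      cases h
    · rw [if_neg (by omega), if_pos (by omega)] at h'
      cases h'

theorem isBigO_log_window :
    Asymptotics.IsBigO Filter.atTop
      (fun n : ℕ => ((4 * (2 * (Nat.log 2 n + 2) + 3) + 2 : ℕ) : ℝ))
      (fun n : ℕ => Real.log (n : ℝ)) := by
  have hlog : Filter.Tendsto (fun n : ℕ => Real.log (n : ℝ)) Filter.atTop Filter.atTop :=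
    Real.tendsto_log_atTop.comp tendsto_natCast_atTop_atTop
  refine Asymptotics.IsBigO.of_bound (8 / Real.log 2 + 30) ?_
  filter_upwards [hlog.eventually_ge_atTop 1] with n hn
  have h : (Nat.log 2 n : ℝ) ≤ Real.log n / Real.log 2 := by
    simpa [Real.logb] using Real.natLog_le_logb n 2
  rw [Real.norm_of_nonneg (Nat.cast_nonneg _), Real.norm_of_nonneg (by linarith)]
  push_cast
  calc (4 * (2 * ((Nat.log 2 n : ℝ) + 2) + 3) + 2) = 8 * (Nat.log 2 n : ℝ) + 30 := by ring
    _ ≤ 8 * (Real.log n / Real.log 2) + 30 * Real.log n := by linarith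
    _ = (8 / Real.log 2 + 30) * Real.log n := by ring

/-! ### From context-free grammars to binary grammars -/

namespace ContextFreeGrammar

variable {T : Type*} (G : ContextFreeGrammar T)

/-- The rules of a grammar of the form `A → B C`, as triples `(A, B, C)`. -/
abbrev BinaryRule : Type :=
  {t : G.NT × G.NT × G.NT //
    ContextFreeRule.mk t.1 [.nonterminal t.2.1, .nonterminal t.2.2] ∈ G.rules}

/-- The binary grammar of a grammar in Chomsky normal form. -/
def toBinaryGrammar : BinaryGrammar T G.NT G.BinaryRule where
  lhs π := π.1.1
  left π := π.1.2.1
  right π := π.1.2.2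
  leaf A x := ∃ a, x = .letter a ∧ ContextFreeRule.mk A [.terminal a] ∈ G.rules
  root := G.initial

/-- A binary rule determines a rule of the grammar. -/
def BinaryRule.toRule (π : G.BinaryRule) : G.rules := ⟨_, π.2⟩

theorem BinaryRule.toRule_injective : Function.Injective (BinaryRule.toRule G) := by
  rintro ⟨⟨A, B, C⟩, h⟩ ⟨⟨A', B', C'⟩, h'⟩ heq
  simpa [toRule] using heq

instance : Finite G.BinaryRule := .of_injective _ (BinaryRule.toRule_injective G)

theorem card_binaryRule_le : Nat.card G.BinaryRule ≤ G.rules.card := by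
  simpa using Nat.card_le_card_of_injective _ (BinaryRule.toRule_injective G)

variable {G}

theorem yields_toBinaryGrammar (hG : IsChomskyNF G) {A : G.NT} {w : List T} :
    G.toBinaryGrammar.Yields A w ↔ G.Yields [.nonterminal A] w := by
  constructor
  · intro h
    induction h with
    | leaf h =>
      obtain ⟨a, rfl, hr⟩ := h
      exact .of_rule hr (.terminal a .nil)
    | node π _ _ ihu ihv => exact .of_rule π.2 (yields_append.2 ⟨_, _, rfl, ihu, ihv⟩)
  · intro h
    have hI : ∀ r ∈ G.rules, ∀ w, interpret G.toBinaryGrammar.Yields r.output w →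
        G.toBinaryGrammar.Yields r.input w := by
      rintro ⟨A, out⟩ hr w hw
      rcases hG _ hr with ⟨a, rfl⟩ | ⟨B, C, rfl⟩
      · obtain ⟨_, rfl, rfl⟩ := hw
        exact .leaf (B := G.toBinaryGrammar) (x := .letter a) ⟨a, rfl, hr⟩
      · obtain ⟨u, _, rfl, hu, v, _, rfl, hv, rfl⟩ := hw
        rw [List.append_nil]
        exact .node (B := G.toBinaryGrammar) ⟨(A, B, C), hr⟩ hu hv
    obtain ⟨u, _, rfl, hu, rfl⟩ := h.interpret hI
    simpa using hu

variable (G) in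
/-- The sentential forms that serve as nonterminals of a binary grammar for an arbitrary grammar:
suffixes of right-hand sides, of the initial nonterminal and of single letters. -/
def relevantForms : Set (List (Symbol T G.NT)) :=
  {α | α <:+ [.nonterminal G.initial] ∨ (∃ r ∈ G.rules, α <:+ r.output) ∨
    ∃ a, α <:+ [.terminal a]}

theorem finite_relevantForms [Finite T] : G.relevantForms.Finite := by
  have hsuff (β : List (Symbol T G.NT)) : {α | α <:+ β}.Finite := by
    simpa only [← List.mem_tails] using List.finite_toSet β.tails
  refine ((hsuff [.nonterminal G.initial]).union
    (((G.rules.finite_toSet.biUnion fun r _ => hsuff r.output)).union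
      (Set.finite_iUnion fun a : T => hsuff [.terminal a]))).subset ?_
  rintro α (h | ⟨r, hr, h⟩ | ⟨a, h⟩)
  · exact .inl h
  · exact .inr (.inl (Set.mem_biUnion hr h))
  · exact .inr (.inr (Set.mem_iUnion.2 ⟨a, h⟩))

theorem mem_relevantForms_of_suffix {α β : List (Symbol T G.NT)} (h : α <:+ β)
    (hβ : β ∈ G.relevantForms) : α ∈ G.relevantForms := by
  rcases hβ with hβ | ⟨r, hr, hβ⟩ | ⟨a, hβ⟩
  · exact .inl (h.trans hβ)
  · exact .inr (.inl ⟨r, hr, h.trans hβ⟩)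
  · exact .inr (.inr ⟨a, h.trans hβ⟩)

/-- The binary rules on sentential forms: a form is split behind its first symbol, and a nonterminal
that is split off is replaced by a right-hand side. -/
inductive IsFormRule (G : ContextFreeGrammar T) :
    List (Symbol T G.NT) → List (Symbol T G.NT) → List (Symbol T G.NT) → Prop
  | rule {r : ContextFreeRule T G.NT} (hr : r ∈ G.rules) (α : List (Symbol T G.NT)) :
      IsFormRule G (.nonterminal r.input :: α) r.output α
  | terminal (a : T) (α : List (Symbol T G.NT)) :
      IsFormRule G (.terminal a :: α) [.terminal a] α

variable (G) in
/-- The triples `(α, β, γ)` of relevant forms with a binary rule `α → β γ`. -/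
abbrev FormRule : Type _ :=
  {t : G.relevantForms × G.relevantForms × G.relevantForms //
    G.IsFormRule t.1.1 t.2.1.1 t.2.2.1}

variable (G) in
/-- A binary grammar for an arbitrary context-free grammar, with sentential forms as nonterminals.
The label `d`, whose brackets are erased, takes care of the empty form. -/
def formGrammar : BinaryGrammar T (List (Symbol T G.NT)) G.FormRule where
  lhs π := π.1.1
  left π := π.1.2.1
  right π := π.1.2.2
  leaf α x := (α = [] ∧ x = .d) ∨ ∃ a, α = [.terminal a] ∧ x = .letter a
  root := [.nonterminal G.initial]

instance [Finite T] : Finite G.FormRule := by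
  have := (finite_relevantForms (G := G)).to_subtype
  infer_instance

theorem yields_formGrammar {α : List (Symbol T G.NT)} (hα : α ∈ G.relevantForms) {w : List T} :
    G.formGrammar.Yields α w ↔ G.Yields α w := by
  constructor
  · clear hα
    intro h
    induction h with
    | leaf h =>
      rcases h with ⟨rfl, rfl⟩ | ⟨a, rfl, rfl⟩
      · exact .nil
      · exact .terminal a .nil
    | @node π u v _ _ ihu ihv =>
      obtain ⟨⟨⟨α, _⟩, ⟨β, _⟩, ⟨γ, _⟩⟩, h⟩ := π
      change G.Yields α _
      replace ihu : G.Yields β u := ihu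
      replace ihv : G.Yields γ v := ihv
      replace h : G.IsFormRule α β γ := h
      cases h with
      | rule hr => exact .rule hr ihu ihv
      | terminal a =>
        exact yields_append (α := [.terminal a]).2 ⟨u, v, rfl, ihu, ihv⟩
  · intro h
    induction h with
    | nil => exact .leaf (B := G.formGrammar) (x := .d) (.inl ⟨rfl, rfl⟩)
    | @terminal a α w h ih =>
      have hα' := mem_relevantForms_of_suffix (List.suffix_cons _ _) hα
      exact .node (B := G.formGrammar)
        ⟨(⟨_, hα⟩, ⟨_, .inr (.inr ⟨a, List.suffix_rfl⟩)⟩, ⟨_, hα'⟩), .terminal a α⟩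
        (.leaf (x := .letter a) (.inr ⟨a, rfl, rfl⟩)) (ih hα')
    | @rule r hr α u v hu hv ihu ihv =>
      have hα' := mem_relevantForms_of_suffix (List.suffix_cons _ _) hα
      have hout : r.output ∈ G.relevantForms := .inr (.inl ⟨r, hr, List.suffix_rfl⟩)
      exact .node (B := G.formGrammar)
        ⟨(⟨_, hα⟩, ⟨_, hout⟩, ⟨_, hα'⟩), .rule hr α⟩ (ihu hout) (ihv hα')

end ContextFreeGrammar

theorem Language.IsContextFree.exists_isRegular {T : Type*} [Finite T] {L : Language T}
    (hL : L.IsContextFree) : ∃ R : Language (StanleyAlphabet T), R.IsRegular ∧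
      L = homImage stanleyHom (dyckLanguage (StanleyLabel T) ⊓ R) := by
  obtain ⟨G, rfl⟩ := hL
  obtain ⟨code, hs⟩ := BinaryGrammar.exists_isSynchronizing (P := G.FormRule)
    (m := 2 * Nat.card G.FormRule) Nat.lt_two_pow_self.le
  refine ⟨(G.formGrammar.automaton code (2 * (2 * Nat.card G.FormRule) + 3)).accepts,
    NFA.isRegular_accepts _, Language.ext fun w => ?_⟩
  rw [BinaryGrammar.mem_homImage_iff_yields (by omega) hs.injective,
    ContextFreeGrammar.mem_language_iff_yields]
  exact (ContextFreeGrammar.yields_formGrammar (.inl List.suffix_rfl)).symm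

theorem IsChomskyNF.exists_isSLT {T : Type*} [Finite T] {G : ContextFreeGrammar T}
    (hG : IsChomskyNF G) : ∃ R : Language (StanleyAlphabet T), R.IsRegular ∧
      G.language = homImage stanleyHom (dyckLanguage (StanleyLabel T) ⊓ R) ∧
      IsSLT (4 * (2 * (Nat.log 2 G.rules.card + 2) + 3) + 2) R := by
  have hcard : 2 * Nat.card G.BinaryRule ≤ 2 ^ (Nat.log 2 G.rules.card + 2) := by
    have h := Nat.lt_pow_succ_log_self (b := 2) (by norm_num) G.rules.card
    have h' := G.card_binaryRule_le
    rw [show Nat.log 2 G.rules.card + 2 = (Nat.log 2 G.rules.card).succ + 1 from rfl, pow_succ]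
    omega
  obtain ⟨code, hs⟩ := BinaryGrammar.exists_isSynchronizing hcard
  refine ⟨(G.toBinaryGrammar.automaton code (2 * (Nat.log 2 G.rules.card + 2) + 3)).accepts,
    NFA.isRegular_accepts _,
    Language.ext fun w => ?_,
    BinaryGrammar.isSLT_accepts_automaton hs fun A x ⟨a, hx, _⟩ => ⟨a, hx⟩⟩
  rw [BinaryGrammar.mem_homImage_iff_yields (by omega) hs.injective,
    ContextFreeGrammar.mem_language_iff_yields]
  exact (ContextFreeGrammar.yields_toBinaryGrammar hG).symm

theorem corollary1 :
    ∃ k : ℕ → ℕ,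
      Asymptotics.IsBigO Filter.atTop (fun n : ℕ => (k n : ℝ)) (fun n : ℕ => Real.log (n : ℝ)) ∧
      ∀ (T : Type*) [Finite T],
        Nat.card (StanleyAlphabet T) = 2 * Nat.card T + 4 ∧
        (∀ L : Language T, L.IsContextFree ↔
          ∃ R : Language (StanleyAlphabet T), R.IsRegular ∧
            L = homImage stanleyHom (dyckLanguage (StanleyLabel T) ⊓ R)) ∧
        (∀ G : ContextFreeGrammar T, IsChomskyNF G →
          ∃ R : Language (StanleyAlphabet T), R.IsRegular ∧
            G.language = homImage stanleyHom (dyckLanguage (StanleyLabel T) ⊓ R) ∧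
            IsSLT (k G.rules.card) R) := by
  refine ⟨fun n => 4 * (2 * (Nat.log 2 n + 2) + 3) + 2, isBigO_log_window, fun T _ =>
    ⟨card_stanleyAlphabet T, fun L => ⟨fun hL => hL.exists_isRegular, ?_⟩,
      fun G hG => hG.exists_isSLT⟩⟩
  rintro ⟨R, hR, rfl⟩
  exact isContextFree_homImage_dyckLanguage_inf stanleyHom hR
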